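/- Let $\mathbb N=\{1,2,3,\dots\}$ and let $w=(w(n))_{n\in\mathbb N}$ be a bounded sequence of strictly positive real numbers. Let $$\ell_1(w)=\Big\{x=(x_n)_{n\in\mathbb N}\in\mathbb C^{\mathbb N}:\ \|x\|_{1,w}:=\sum_{n=1}^\infty w(n)|x_n|<\infty\Big\},$$ which is a Banach space for the norm $\|\cdot\|_{1,w}$. Let $\mathsf C$ be the discrete Cesàro operator on $\mathbb C^{\mathbb N}$, that is, $(\mathsf Cx)_n=\frac1n\sum_{k=1}^n x_k$ for $n\in\mathbb N$. Suppose that $\mathsf C$ maps $\ell_1(w)$ into itself and that its restriction $\mathsf C^{(1,w)}:\ell_1(w)\to\ell_1(w)$ is a compact operator. Then the following hold. (i) The point spectrum (the set of all eigenvalues) of $\mathsf C^{(1,w)}$ is $\sigma_{pt}(\mathsf C^{(1,w)})=\{\tfrac1n:n\in\mathbb N\}$, and its spectrum is $\sigma(\mathsf C^{(1,w)})=\{0\}\cup\{\tfrac1n:n\in\mathbb N\}$. (ii) The sequence $w$ is rapidly decreasing, that is, $\sum_{n=1}^\infty n^k w(n)<\infty$ for every $k\in\mathbb N$. -/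

import Mathlib

noncomputable section

/-- A weight: a bounded, strictly positive sequence `w = (w(n))`, indexed by `n = 1, 2, 3, …`. -/
structure Weight where
  toFun : ℕ+ → ℝ
  pos : ∀ n, 0 < toFun n
  bounded : ∃ M : ℝ, ∀ n, toFun n ≤ M

instance : CoeFun Weight (fun _ => ℕ+ → ℝ) := ⟨Weight.toFun⟩

/-- The vector subspace of all complex sequences `x` with `∑ w(n) |x_n| < ∞`. -/
def weightedSubmodule (w : Weight) : Submodule ℂ (ℕ+ → ℂ) where
  carrier := {x | Summable fun n => w n * ‖x n‖}
  zero_mem' := by simp [summable_zero]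
  add_mem' := by
    intro x y hx hy
    refine Summable.of_nonneg_of_le (fun n => mul_nonneg (w.pos n).le (norm_nonneg _))
      (fun n => ?_) (Summable.add hx hy)
    rw [← mul_add]
    exact mul_le_mul_of_nonneg_left (norm_add_le _ _) (w.pos n).le
  smul_mem' := by
    intro c x hx
    refine (Summable.mul_left ‖c‖ hx).congr fun n => ?_
    simp only [Pi.smul_apply, smul_eq_mul, norm_mul]
    ring

/-- The space `ℓ₁(w)`. It is a type of its own, so that it does not carry the topology of
coordinatewise convergence as a subspace of the space of all sequences, but only the topology
of the norm below. -/
def WeightedL1 (w : Weight) : Type := weightedSubmodule w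

namespace WeightedL1

variable (w : Weight)

instance : AddCommGroup (WeightedL1 w) := inferInstanceAs (AddCommGroup (weightedSubmodule w))

instance : Module ℂ (WeightedL1 w) := inferInstanceAs (Module ℂ (weightedSubmodule w))

/-- The inclusion of `ℓ₁(w)` in the space of all complex sequences. -/
def toSeq : WeightedL1 w →ₗ[ℂ] (ℕ+ → ℂ) := (weightedSubmodule w).subtype

theorem toSeq_injective : Function.Injective (toSeq w) := Subtype.val_injective

theorem summable_toSeq (x : WeightedL1 w) : Summable fun n => w n * ‖toSeq w x n‖ := x.2

/-- The norm `‖x‖ = ∑ w(n) |x_n|`. -/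
instance : Norm (WeightedL1 w) := ⟨fun x => ∑' n, w n * ‖toSeq w x n‖⟩

theorem norm_def (x : WeightedL1 w) : ‖x‖ = ∑' n, w n * ‖toSeq w x n‖ := rfl

theorem normCore : NormedSpace.Core ℂ (WeightedL1 w) where
  norm_nonneg x := tsum_nonneg fun n => mul_nonneg (w.pos n).le (norm_nonneg _)
  norm_smul c x := by
    simp only [norm_def, map_smul, Pi.smul_apply, smul_eq_mul, norm_mul]
    rw [← tsum_mul_left]
    exact tsum_congr fun n => by ring
  norm_triangle x y := by
    simp only [norm_def]
    rw [← (summable_toSeq w x).tsum_add (summable_toSeq w y)]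
    refine (summable_toSeq w (x + y)).tsum_le_tsum (fun n => ?_)
      ((summable_toSeq w x).add (summable_toSeq w y))
    rw [← mul_add, map_add]
    exact mul_le_mul_of_nonneg_left (norm_add_le _ _) (w.pos n).le
  norm_eq_zero_iff x := by
    constructor
    · intro h
      have hs := (summable_toSeq w x).hasSum
      rw [← norm_def, h, hasSum_zero_iff_of_nonneg
        (fun n => mul_nonneg (w.pos n).le (norm_nonneg _))] at hs
      apply toSeq_injective w
      ext n
      have hn := congrFun hs n
      simpa [(w.pos n).ne'] using hn
    · rintro rfl
      simp [norm_def]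

instance : NormedAddCommGroup (WeightedL1 w) := NormedAddCommGroup.ofCore (normCore w)

instance : NormedSpace ℂ (WeightedL1 w) := NormedSpace.ofCore (normCore w)

end WeightedL1

/-- The discrete Cesàro operator `C x = (x₁, (x₁ + x₂)/2, …, (x₁ + ⋯ + x_n)/n, …)` on the space
of all complex sequences. -/
def cesaro : (ℕ+ → ℂ) →ₗ[ℂ] (ℕ+ → ℂ) where
  toFun x n := (∑ k ∈ Finset.Icc 1 n, x k) / (n : ℂ)
  map_add' x y := by
    ext n
    simp [Finset.sum_add_distrib, add_div]
  map_smul' c x := by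
    ext n
    simp [← Finset.mul_sum, mul_div_assoc]

/-- The Cesàro operator acts in `ℓ₁(w)`, that is, it maps `ℓ₁(w)` into itself. -/
def CesaroActs (w : Weight) : Prop :=
  ∀ x ∈ weightedSubmodule w, cesaro x ∈ weightedSubmodule w

/-- The Cesàro operator, restricted to a linear map of `ℓ₁(w)` into itself. -/
def cesaroOn (w : Weight) (h : CesaroActs w) : WeightedL1 w →ₗ[ℂ] WeightedL1 w :=
  cesaro.restrict h

/-- The point spectrum of a bounded operator: the set of its eigenvalues. -/
def pointSpectrum {X : Type*} [NormedAddCommGroup X] [NormedSpace ℂ X] (T : X →L[ℂ] X) : Set ℂ :=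
  {z | Module.End.HasEigenvalue (T : Module.End ℂ X) z}

/-- The space `s` of rapidly decreasing sequences: `(n ^ k x_n)` is absolutely summable for
every `k`. -/
def rapidlyDecreasing : Set (ℕ+ → ℂ) :=
  {x | ∀ k : ℕ, Summable fun n : ℕ+ => ‖(n : ℂ) ^ k * x n‖}

end

/-! The spectral statements rest on the Fredholm alternative: a nonzero spectral value of a compact
operator on a Banach space is an eigenvalue.

If the coordinates of `x` vanish before `m`, then `(C x)_m = x_m / m`. Applied at the first
nonzero coordinate of an eigenvector, this shows that every eigenvalue is some `1 / m`. Applied by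
forward substitution to the equation `x / m - C x = e_m`, it gives first `x_k = 0` for `k < m` and then
`0 = 1` in coordinate `m`; so `1 / m - C` is not surjective, `1 / m` is in the spectrum, and by the
Fredholm alternative it is an eigenvalue. Since the spectrum is closed, it also contains `0`.

An eigenvector for `1 / (k + 1)` is a nonzero multiple of the sequence `binom (n - 1) k`, which
grows like `n ^ k`. As it belongs to `ℓ₁(w)`, the sum `∑ n ^ k w(n)` is finite. -/

/-! ### Completeness of the weighted space -/

namespace WeightedL1

/-- Multiplication by the weight, as a linear map from `ℓ₁(w)` to the unweighted space `ℓ₁`. -/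
def toLp (w : Weight) : WeightedL1 w →ₗ[ℂ] lp (fun _ : ℕ+ => ℂ) 1 where
  toFun x := ⟨fun n => (w n : ℂ) * toSeq w x n, by
    refine memℓp_gen ((summable_toSeq w x).congr fun n => ?_)
    simp [abs_of_pos (w.pos n)]⟩
  map_add' x y := by
    ext n
    simp only [map_add, Pi.add_apply, mul_add]
    rfl
  map_smul' c x := by
    ext n
    simp [mul_left_comm]

theorem toLp_apply (w : Weight) (x : WeightedL1 w) (n : ℕ+) :
    toLp w x n = (w n : ℂ) * toSeq w x n := rfl

theorem norm_toLp (w : Weight) (x : WeightedL1 w) : ‖toLp w x‖ = ‖x‖ := by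
  rw [lp.norm_eq_tsum_rpow (by simp), norm_def]
  simp [toLp_apply, abs_of_pos (w.pos _)]

theorem toLp_surjective (w : Weight) : Function.Surjective (toLp w) := by
  intro y
  have hw (n : ℕ+) : (w n : ℂ) ≠ 0 := by exact_mod_cast (w.pos n).ne'
  have hy : (fun n => y n / w n) ∈ weightedSubmodule w := by
    have h := (lp.memℓp y).summable (by simp)
    refine h.congr fun n => ?_
    have := (w.pos n).ne'
    simp [abs_of_pos (w.pos n)]
    field_simp
  refine ⟨⟨_, hy⟩, ?_⟩
  ext n
  exact mul_div_cancel₀ (y n) (hw n)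

instance (w : Weight) : CompleteSpace (WeightedL1 w) :=
  let e : WeightedL1 w ≃ᵢ lp (fun _ : ℕ+ => ℂ) 1 := IsometryEquiv.mk
    (Equiv.ofBijective (toLp w)
      ⟨(AddMonoidHomClass.isometry_of_norm (toLp w) (norm_toLp w)).injective, toLp_surjective w⟩)
    (AddMonoidHomClass.isometry_of_norm (toLp w) (norm_toLp w))
  e.completeSpace

end WeightedL1

/-! ### The Cesàro operator on sequences -/

theorem cesaro_apply_of_forall_lt {x : ℕ+ → ℂ} {m : ℕ+} (hx : ∀ k < m, x k = 0) :
    cesaro x m = x m / (m : ℂ) := by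
  have h : ∑ k ∈ Finset.Icc 1 m, x k = x m :=
    Finset.sum_eq_single_of_mem m (by simp) fun k hk hkm =>
      hx k (lt_of_le_of_ne (Finset.mem_Icc.1 hk).2 hkm)
  exact congrArg (· / (m : ℂ)) h

theorem natCast_mul_cesaro (x : ℕ+ → ℂ) (n : ℕ+) :
    (n : ℂ) * cesaro x n = ∑ k ∈ Finset.Icc 1 n, x k :=
  mul_div_cancel₀ _ (by simp)

theorem add_one_mul_cesaro_add_one (x : ℕ+ → ℂ) (n : ℕ+) :
    ((n : ℂ) + 1) * cesaro x (n + 1) = n * cesaro x n + x (n + 1) := by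
  have hI : Finset.Icc 1 (n + 1) = insert (n + 1) (Finset.Icc 1 n) := by
    ext k
    simp only [Finset.mem_Icc, Finset.mem_insert, one_le, true_and]
    rw [le_iff_eq_or_lt, PNat.lt_add_one_iff]
  have h := natCast_mul_cesaro x (n + 1)
  rw [hI, Finset.sum_insert (by simp), ← natCast_mul_cesaro] at h
  push_cast at h
  rw [h, add_comm]

/-- An eigenvalue of the Cesàro operator is `1 / m`, where `m` is the index of the first nonzero
coordinate of the eigenvector. -/
theorem exists_eq_one_div_of_cesaro_eq_smul {x : ℕ+ → ℂ} {z : ℂ} (hx : x ≠ 0)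
    (h : cesaro x = z • x) :
    ∃ m : ℕ+, z = 1 / (m : ℂ) ∧ x m ≠ 0 ∧ ∀ k < m, x k = 0 := by
  have hne : ∃ m, x m ≠ 0 := Function.ne_iff.1 hx
  classical
  refine ⟨PNat.find hne, ?_, PNat.find_spec hne, fun k hk => by simpa using PNat.find_min hne hk⟩
  have h1 := cesaro_apply_of_forall_lt (x := x) (m := PNat.find hne)
    fun k hk => by simpa using PNat.find_min hne hk
  have h2 := PNat.find_spec hne
  rw [h, Pi.smul_apply, smul_eq_mul] at h1
  apply mul_right_cancel₀ h2
  rw [h1]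
  ring

/-- The unit vector `e_m` is not in the range of `1 / m - C`. -/
theorem one_div_smul_sub_cesaro_ne_single (m : ℕ+) (x : ℕ+ → ℂ) :
    (1 / (m : ℂ)) • x - cesaro x ≠ Pi.single m 1 := by
  intro h
  -- Forward substitution: coordinate `k < m` of the equation reads `(1 / m - 1 / k) x_k = 0`.
  have hzero (k : ℕ+) : k < m → x k = 0 := by
    induction k using PNat.strongInductionOn with
    | _ k ih =>
      intro hk
      have h1 := congrFun h k
      rw [Pi.sub_apply, cesaro_apply_of_forall_lt fun j hj => ih j hj (hj.trans hk),
        Pi.single_eq_of_ne hk.ne, Pi.smul_apply, smul_eq_mul] at h1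
      have h2 : (1 / (m : ℂ) - 1 / (k : ℂ)) * x k = 0 := by rw [← h1]; ring
      refine (mul_eq_zero.1 h2).resolve_left fun h3 => hk.ne ?_
      have h4 : (m : ℂ) = k := by simpa [sub_eq_zero] using h3
      exact_mod_cast h4.symm
  have h1 := congrFun h m
  rw [Pi.sub_apply, cesaro_apply_of_forall_lt hzero, Pi.single_eq_same, Pi.smul_apply,
    smul_eq_mul] at h1
  exact zero_ne_one (by rw [← h1]; ring)

/-- An eigenvector for `1 / (k + 1)` is a multiple of the binomial sequence `binom (n - 1) k`;
with `n = k + 1 + d` this is `binom (k + d) k`. -/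
theorem eq_choose_mul_of_cesaro_eq {x : ℕ+ → ℂ} {m : ℕ+} {k : ℕ} (hm : (m : ℕ) = k + 1)
    (h : cesaro x = (1 / (m : ℂ)) • x) (d : ℕ) (n : ℕ+) (hn : (n : ℕ) = k + 1 + d) :
    x n = ((k + d).choose k : ℂ) * x m := by
  induction d generalizing n with
  | zero =>
    obtain rfl : n = m := PNat.eq (by omega)
    simp
  | succ d ih =>
    obtain ⟨p, rfl⟩ : ∃ p : ℕ+, n = p + 1 := by
      refine ⟨⟨k + 1 + d, by omega⟩, PNat.eq ?_⟩
      rw [hn]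
      rfl
    have hp : (p : ℕ) = k + 1 + d := by
      have : ((p + 1 : ℕ+) : ℕ) = p + 1 := rfl
      omega
    have hrec := add_one_mul_cesaro_add_one x p
    rw [h, Pi.smul_apply, Pi.smul_apply, smul_eq_mul, smul_eq_mul, ih p hp] at hrec
    have hm' : (m : ℂ) = k + 1 := by exact_mod_cast hm
    have hp' : (p : ℂ) = k + 1 + d := by exact_mod_cast hp
    have hk : (k : ℂ) + 1 ≠ 0 := Nat.cast_add_one_ne_zero k
    have hd : (d : ℂ) + 1 ≠ 0 := Nat.cast_add_one_ne_zero d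
    rw [hm', hp'] at hrec
    have hc : ((k + d + 1).choose k : ℂ) * (d + 1) = (k + d).choose k * (k + d + 1) := by
      have := Nat.choose_mul_succ_eq (k + d) k
      rw [show k + d + 1 - k = d + 1 by omega] at this
      exact_mod_cast this.symm
    field_simp at hrec
    apply mul_right_cancel₀ hd
    rw [← add_assoc]
    linear_combination hrec - x m * hc

/-- The binomial sequence `binom (n - 1) k` grows at least like `n ^ k`. -/
theorem pow_le_mul_choose (k d : ℕ) :
    (k + 1 + d) ^ k ≤ (k + 1) ^ k * k.factorial * (k + d).choose k := by
  have h1 : (d + 1) ^ k ≤ k.factorial * (k + d).choose k := by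
    have := Nat.pow_sub_le_descFactorial (k + d) k
    rw [Nat.descFactorial_eq_factorial_mul_choose] at this
    rwa [show k + d + 1 - k = d + 1 by omega] at this
  calc (k + 1 + d) ^ k ≤ ((k + 1) * (d + 1)) ^ k := Nat.pow_le_pow_left (by nlinarith) k
    _ = (k + 1) ^ k * (d + 1) ^ k := mul_pow _ _ _
    _ ≤ (k + 1) ^ k * (k.factorial * (k + d).choose k) := Nat.mul_le_mul_left _ h1
    _ = _ := (mul_assoc _ _ _).symm

/-! ### Spectrum of the compact Cesàro operator -/

namespace WeightedL1

variable {w : Weight}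

/-- The unit vectors belong to `ℓ₁(w)`. -/
theorem exists_toSeq_eq_single (w : Weight) (m : ℕ+) :
    ∃ y : WeightedL1 w, toSeq w y = Pi.single m 1 := by
  refine ⟨⟨Pi.single m 1, ?_⟩, rfl⟩
  refine summable_of_ne_finset_zero (s := {m}) fun n hn => ?_
  simp [Pi.single_eq_of_ne (Finset.notMem_singleton.1 hn)]

theorem one_div_mem_spectrum {T : WeightedL1 w →L[ℂ] WeightedL1 w}
    (hT : ∀ x, toSeq w (T x) = cesaro (toSeq w x)) (m : ℕ+) : 1 / (m : ℂ) ∈ spectrum ℂ T := by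
  rw [spectrum.mem_iff]
  rintro ⟨u, hu⟩
  obtain ⟨y, hy⟩ := exists_toSeq_eq_single w m
  refine one_div_smul_sub_cesaro_ne_single m
    (toSeq w ((↑u⁻¹ : WeightedL1 w →L[ℂ] WeightedL1 w) y)) ?_
  have h := congrArg (fun S : WeightedL1 w →L[ℂ] WeightedL1 w => S y) u.mul_inv
  simp only [hu] at h
  rw [← hy, ← hT, ← map_smul, ← map_sub]
  exact congrArg (toSeq w) h

/-- If `1 / (k + 1)` has an eigenvector in `ℓ₁(w)`, then `∑ n ^ k w(n)` is finite. -/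
theorem summable_pow_mul_of_cesaro_eq {x : WeightedL1 w} {m : ℕ+} {k : ℕ} (hm : (m : ℕ) = k + 1)
    (h : cesaro (toSeq w x) = (1 / (m : ℂ)) • toSeq w x) (hx : toSeq w x m ≠ 0) :
    Summable fun n : ℕ+ => ‖(n : ℂ) ^ k * (w n : ℂ)‖ := by
  set c : ℝ := (k + 1) ^ k * k.factorial / ‖toSeq w x m‖ with hc
  refine Summable.of_norm_bounded_eventually ((summable_toSeq w x).mul_left c) ?_
  -- The coordinates of `x` before `m` vanish, so the comparison can only hold from `m` on.
  refine (Set.finite_Iio m).subset fun n hn => ?_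
  by_contra hmn
  refine hn ?_
  rw [Set.mem_ofPred_eq]
  obtain ⟨d, hd⟩ := Nat.exists_eq_add_of_le (show (m : ℕ) ≤ n from not_lt.1 hmn)
  have hxn := eq_choose_mul_of_cesaro_eq hm h d n (by omega)
  have hpos : 0 < ‖toSeq w x m‖ := norm_pos_iff.2 hx
  have hle : ((n : ℕ) : ℝ) ^ k ≤ (k + 1) ^ k * k.factorial * (k + d).choose k := by
    rw [hd, hm]
    exact_mod_cast pow_le_mul_choose k d
  have hrw : c * (w n * ‖toSeq w x n‖) = w n * ((k + 1) ^ k * k.factorial * (k + d).choose k) := by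
    rw [hxn, norm_mul, Complex.norm_natCast, hc]
    field_simp
  rw [hrw, norm_norm, norm_mul, norm_pow, Complex.norm_natCast, Complex.norm_real,
    Real.norm_of_nonneg (w.pos n).le, mul_comm]
  exact mul_le_mul_of_nonneg_left hle (w.pos n).le

end WeightedL1

theorem proposition3p10 (w : Weight) (hact : CesaroActs w)
    (hcomp : IsCompactOperator (cesaroOn w hact)) :
    pointSpectrum (ContinuousLinearMap.mkOfIsCompactOperator hcomp) =
        Set.range (fun n : ℕ+ => 1 / (n : ℂ)) ∧
      spectrum ℂ (ContinuousLinearMap.mkOfIsCompactOperator hcomp) =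
        {0} ∪ Set.range (fun n : ℕ+ => 1 / (n : ℂ)) ∧
      (fun n => (w n : ℂ)) ∈ rapidlyDecreasing := by
  set T := ContinuousLinearMap.mkOfIsCompactOperator hcomp
  have hT (x : WeightedL1 w) : WeightedL1.toSeq w (T x) = cesaro (WeightedL1.toSeq w x) := rfl
  have hTc : IsCompactOperator T := hcomp
  have hdiv (m : ℕ+) : 1 / (m : ℂ) ≠ 0 := by simp
  have hvec {z : ℂ} (hz : Module.End.HasEigenvalue (T : Module.End ℂ (WeightedL1 w)) z) :
      ∃ x : WeightedL1 w, cesaro (WeightedL1.toSeq w x) = z • WeightedL1.toSeq w x ∧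
        WeightedL1.toSeq w x ≠ 0 := by
    obtain ⟨x, hx⟩ := hz.exists_hasEigenvector
    refine ⟨x, ?_, fun h0 => hx.2 (WeightedL1.toSeq_injective w (by rw [h0, map_zero]))⟩
    rw [← map_smul]
    exact congrArg (WeightedL1.toSeq w) hx.apply_eq_smul
  have hsub {z : ℂ} (hz : Module.End.HasEigenvalue (T : Module.End ℂ (WeightedL1 w)) z) :
      z ∈ Set.range (fun n : ℕ+ => 1 / (n : ℂ)) := by
    obtain ⟨x, hx, hx0⟩ := hvec hz
    obtain ⟨m, hm, -⟩ := exists_eq_one_div_of_cesaro_eq_smul hx0 hx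
    exact ⟨m, hm.symm⟩
  have heig (m : ℕ+) : Module.End.HasEigenvalue (T : Module.End ℂ (WeightedL1 w)) (1 / (m : ℂ)) :=
    (hTc.hasEigenvalue_iff_mem_spectrum (hdiv m)).2 (WeightedL1.one_div_mem_spectrum hT m)
  refine ⟨Set.Subset.antisymm (fun z hz => hsub hz) ?_, Set.Subset.antisymm (fun z hz => ?_) ?_, ?_⟩
  · rintro _ ⟨m, rfl⟩
    exact heig m
  · rcases eq_or_ne z 0 with h0 | h0
    · exact Or.inl h0
    · exact Or.inr (hsub ((hTc.hasEigenvalue_iff_mem_spectrum h0).2 hz))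
  · rintro _ (rfl | ⟨m, rfl⟩)
    -- `0` is the limit of the spectral values `1 / (n + 1)`, and the spectrum is closed.
    · have hlim := tendsto_one_div_add_atTop_nhds_zero_nat (𝕜 := ℂ)
      refine (spectrum.isClosed T).mem_of_tendsto hlim (Filter.Eventually.of_forall fun n => ?_)
      simpa using WeightedL1.one_div_mem_spectrum hT n.succPNat
    · exact WeightedL1.one_div_mem_spectrum hT m
  · intro k
    obtain ⟨x, hx, hx0⟩ := hvec (heig k.succPNat)
    obtain ⟨m, hm, hxm, -⟩ := exists_eq_one_div_of_cesaro_eq_smul hx0 hx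
    have hmk : k.succPNat = m := by
      have : ((k.succPNat : ℕ) : ℂ) = (m : ℕ) := by simpa only [one_div, inv_inj] using hm
      exact PNat.eq (by exact_mod_cast this)
    subst hmk
    exact WeightedL1.summable_pow_mul_of_cesaro_eq (Nat.succPNat_coe k) hx hxm
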